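/- Let $q_1,q_2,q_3\in\mathbb{R}^2$ be the vertices of an equilateral triangle, let $P_i(x)=\frac12(x+q_i)$, and let $SG$ be the Sierpinski gasket, i.e. the unique nonempty compact set with $SG=\bigcup_{i=1}^3P_i(SG)$. Put $q_{ij}=P_i(q_j)$, $V_0=\{q_1,q_2,q_3\}$, $V_m=\bigcup_{|\omega|=m}P_\omega(V_0)$, where $P_\omega=P_{\omega_1}\circ\cdots\circ P_{\omega_m}$ for a word $\omega=\omega_1\cdots\omega_m$ over $\{1,2,3\}$, and write $x\sim_m y$ if $x\ne y$ and $x,y\in P_\omega(V_0)$ for some word $\omega$ of length $m$. For a continuous $u:SG\to\mathbb{R}$ let $\mathcal{E}_m(u)=(5/3)^m\sum_{x\sim_m y}(u(x)-u(y))^2$ (each edge counted once) and $\Delta_mu(x)=\sum_{y\sim_m x}(u(y)-u(x))$ for $x\in V_m\setminus V_0$. Call $u$ harmonic if $\mathcal{E}_{m-1}(u)=\mathcal{E}_m(u)$ for all $m\ge1$. For a continuous $g:SG\to\mathbb{R}$ we say $\Delta u=g$ if $\sup_{x\in V_m\setminus V_0}\left|\frac32 5^m\Delta_mu(x)-g(x)\right|\to0$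 as $m\to\infty$; we say $\Delta u=\eta$ on $SG\setminus V_0$, for $\eta\in\mathbb{R}$, if $\Delta u=g$ for some continuous $g$ on $SG$ with $g(x)=\eta$ for all $x\in SG\setminus V_0$. A continuous $f:SG\to\mathbb{R}$ is a fractal interpolation function (FIF) with uniform vertical scaling factor $d\in(-1,1)$ if there are harmonic functions $h_1,h_2,h_3$ on $SG$ with $f(P_i(x))=d\,f(x)+h_i(x)$ for all $x\in SG$ and $i=1,2,3$. Let $a_1,a_2,a_3,\eta$ be real numbers. Then the Dirichlet problem $$u(q_i)=a_i\quad(i=1,2,3),\qquad \Delta u=\eta\ \text{ on } SG\setminus V_0$$ has a unique solution $u$ among the continuous functions on $SG$. A continuous function $u$ on $SG$ is this solution if and only if it is an FIF with uniform vertical scaling factor $\frac15$ such that $u(q_i)=a_i$ for $i=1,2,3$ and $$u(q_{ij})=\frac15\Big(2a_i+2a_j+a_k-\frac{\eta}{3}\Big)\qquad\text{whenever }\{i,j,k\}=\{1,2,3\}.$$ In particular, for $\eta=0$ the solution is the harmonic function with boundary values $a_1,a_2,a_3$ (a continuous function on $SG$ solves the problem with $\eta=0$ if and only if it is harmonic and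 takes the values $a_i$ at $q_i$), and this harmonic function is an FIF of the above form with $\eta=0$. -/

import Mathlib

noncomputable section

namespace SierpinskiGasket

/-- The three vertices of an equilateral triangle in the Euclidean plane. -/
def vertex : Fin 3 → EuclideanSpace ℝ (Fin 2) :=
  ![!₂[0, 0], !₂[1, 0], !₂[1 / 2, Real.sqrt 3 / 2]]

/-- The similitude of ratio `1/2` of the plane with fixed point `vertex i`. -/
def contraction (i : Fin 3) (x : EuclideanSpace ℝ (Fin 2)) : EuclideanSpace ℝ (Fin 2) :=
  (1 / 2 : ℝ) • (x + vertex i)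

/-- The point of the plane with address `ω₀ω₁ω₂…`. -/
def addressPoint (ω : ℕ → Fin 3) : EuclideanSpace ℝ (Fin 2) :=
  ∑' n : ℕ, ((1 / 2 : ℝ) ^ (n + 1)) • vertex (ω n)

/-- The Sierpinski gasket, as a subset of the plane. By `gasket_isAttractor` and
`isAttractor_unique` below it is the unique nonempty compact set `K` with
`K = ⋃ i, contraction i '' K`. -/
def gasket : Set (EuclideanSpace ℝ (Fin 2)) := Set.range addressPoint

/-- A nonempty compact set that is invariant under the iterated function system. -/
structure IsAttractor (K : Set (EuclideanSpace ℝ (Fin 2))) : Prop where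
  nonempty : K.Nonempty
  isCompact : IsCompact K
  self_similar : K = ⋃ i, contraction i '' K

theorem norm_vertex_le (i : Fin 3) : ‖vertex i‖ ≤ 1 := by
  rw [EuclideanSpace.norm_eq, Real.sqrt_le_one]
  fin_cases i <;> simp [vertex, Fin.sum_univ_two, div_pow]
  norm_num

theorem norm_term_le (ω : ℕ → Fin 3) (n : ℕ) :
    ‖((1 / 2 : ℝ) ^ (n + 1)) • vertex (ω n)‖ ≤ (1 / 2 : ℝ) ^ n := by
  rw [norm_smul, norm_pow, Real.norm_of_nonneg (by norm_num : (0 : ℝ) ≤ 1 / 2), pow_succ]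
  have h := norm_vertex_le (ω n)
  have h2 : (0 : ℝ) < (1 / 2 : ℝ) ^ n := by positivity
  nlinarith

theorem summable_address (ω : ℕ → Fin 3) :
    Summable fun n : ℕ => ((1 / 2 : ℝ) ^ (n + 1)) • vertex (ω n) :=
  Summable.of_norm_bounded summable_geometric_two (norm_term_le ω)

theorem continuous_addressPoint : Continuous addressPoint := by
  refine continuous_tsum (fun n => ?_) summable_geometric_two (fun n ω => norm_term_le ω n)
  have h : Continuous fun ω : ℕ → Fin 3 => vertex (ω n) :=
    Continuous.comp (continuous_of_discreteTopology (f := vertex)) (continuous_apply n)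
  exact h.const_smul ((1 / 2 : ℝ) ^ (n + 1))

theorem addressPoint_eq (ω : ℕ → Fin 3) :
    addressPoint ω = contraction (ω 0) (addressPoint fun n => ω (n + 1)) := by
  unfold addressPoint contraction
  rw [(summable_address ω).tsum_eq_zero_add, smul_add, ← (summable_address _).tsum_const_smul,
    add_comm]
  congr 1
  · refine tsum_congr fun n => ?_
    rw [smul_smul, pow_succ' _ (n + 1)]
  · simp

theorem gasket_isAttractor : IsAttractor gasket where
  nonempty := Set.range_nonempty _
  isCompact := isCompact_range continuous_addressPoint
  self_similar := by
    ext x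
    simp only [gasket, Set.mem_iUnion, Set.mem_image, Set.mem_range]
    constructor
    · rintro ⟨ω, rfl⟩
      exact ⟨ω 0, _, ⟨fun n => ω (n + 1), rfl⟩, (addressPoint_eq ω).symm⟩
    · rintro ⟨i, _, ⟨ω, rfl⟩, rfl⟩
      refine ⟨fun n => match n with | 0 => i | k + 1 => ω k, ?_⟩
      rw [addressPoint_eq]

theorem isAttractor_unique {K L : Set (EuclideanSpace ℝ (Fin 2))}
    (hK : IsAttractor K) (hL : IsAttractor L) : K = L := by
  have key : ∀ {A B : Set (EuclideanSpace ℝ (Fin 2))}, IsAttractor A → IsAttractor B →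
      A ⊆ B := by
    intro A B hA hB
    obtain ⟨C, hC⟩ := (hA.isCompact.isBounded.union hB.isCompact.isBounded).exists_norm_le
    have step : ∀ n : ℕ, ∀ x ∈ A, ∃ y ∈ B, ‖x - y‖ ≤ (1 / 2 : ℝ) ^ n * (2 * C) := by
      intro n
      induction n with
      | zero =>
        intro x hx
        obtain ⟨y, hy⟩ := hB.nonempty
        refine ⟨y, hy, ?_⟩
        have h1 := hC x (Or.inl hx)
        have h2 := hC y (Or.inr hy)
        have h3 := norm_sub_le x y
        simp only [pow_zero, one_mul]
        linarith
      | succ n ih =>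
        intro x hx
        rw [hA.self_similar] at hx
        simp only [Set.mem_iUnion, Set.mem_image] at hx
        obtain ⟨i, x', hx', rfl⟩ := hx
        obtain ⟨y', hy', h⟩ := ih x' hx'
        refine ⟨contraction i y', ?_, ?_⟩
        · rw [hB.self_similar]
          exact Set.mem_iUnion.2 ⟨i, y', hy', rfl⟩
        · have e : contraction i x' - contraction i y' = (1 / 2 : ℝ) • (x' - y') := by
            unfold contraction
            module
          rw [e, norm_smul, Real.norm_of_nonneg (by norm_num : (0 : ℝ) ≤ 1 / 2), pow_succ]
          linarith
    intro x hx
    rw [← hB.isCompact.isClosed.closure_eq, Metric.mem_closure_iff]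
    intro ε hε
    have ht : Filter.Tendsto (fun n : ℕ => (1 / 2 : ℝ) ^ n * (2 * C)) Filter.atTop (nhds 0) := by
      simpa using (tendsto_pow_atTop_nhds_zero_of_lt_one (by norm_num : (0 : ℝ) ≤ 1 / 2)
        (by norm_num)).mul_const (2 * C)
    obtain ⟨n, hn⟩ := (ht.eventually_lt_const hε).exists
    obtain ⟨y, hy, h⟩ := step n x hx
    exact ⟨y, hy, by rw [dist_eq_norm]; linarith⟩
  exact Set.Subset.antisymm (key hK hL) (key hL hK)

theorem contraction_mem {i : Fin 3} {x : EuclideanSpace ℝ (Fin 2)} (hx : x ∈ gasket) :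
    contraction i x ∈ gasket := by
  rw [gasket_isAttractor.self_similar]
  exact Set.mem_iUnion.2 ⟨i, x, hx, rfl⟩

theorem vertex_mem (i : Fin 3) : vertex i ∈ gasket := by
  refine ⟨fun _ => i, ?_⟩
  have h := addressPoint_eq fun _ => i
  unfold contraction at h
  have h2 : (2 : ℝ) • addressPoint (fun _ => i) = addressPoint (fun _ => i) + vertex i := by
    conv_lhs => rw [h]
    module
  rw [two_smul] at h2
  exact add_left_cancel h2

/-- The Sierpinski gasket as a topological space (with the subspace topology). -/
abbrev SG : Type := gasket

/-- The boundary points `q i` of `SG`. -/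
def q (i : Fin 3) : SG := ⟨vertex i, vertex_mem i⟩

/-- The maps `P i : SG → SG`. -/
def P (i : Fin 3) (x : SG) : SG := ⟨contraction i x, contraction_mem x.2⟩

/-- `Pword [ω₁, …, ωₘ] = P ω₁ ∘ ⋯ ∘ P ωₘ`. -/
def Pword : List (Fin 3) → SG → SG
  | [] => id
  | i :: w => P i ∘ Pword w

open scoped Classical in
/-- `V m` is the union of the sets `Pword ω {q 0, q 1, q 2}` over the words `ω` of length `m`. -/
def V (m : ℕ) : Finset SG :=
  Finset.univ.image fun p : (Fin m → Fin 3) × Fin 3 => Pword (List.ofFn p.1) (q p.2)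

/-- The edge relation of the graph on `V m`: two different points are joined when they are
vertices of a common cell of level `m`. -/
def Adj (m : ℕ) (x y : SG) : Prop :=
  x ≠ y ∧ ∃ w : List (Fin 3), w.length = m ∧
    (∃ i, x = Pword w (q i)) ∧ (∃ j, y = Pword w (q j))

open scoped Classical in
/-- The graph energy (conductances `1` on `V 0`, renormalization factors `3/5`). Every edge occurs
as two ordered pairs, whence the factor `1/2`. -/
def graphEnergy (m : ℕ) (u : SG → ℝ) : ℝ :=
  (5 / 3 : ℝ) ^ m *
    ((1 / 2 : ℝ) * ∑ x ∈ V m, ∑ y ∈ (V m).filter (fun y => Adj m x y), (u x - u y) ^ 2)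

/-- A harmonic function on `SG`: the graph energies do not change with the level. -/
def IsHarmonic (u : C(SG, ℝ)) : Prop :=
  ∀ m : ℕ, graphEnergy m u = graphEnergy (m + 1) u

/-- `f` is a fractal interpolation function with vertical scaling factors `d i`
(its basic function is the restriction of `f` to `V 1`). -/
def IsFIF (d : Fin 3 → ℝ) (f : C(SG, ℝ)) : Prop :=
  (∀ i, d i ∈ Set.Ioo (-1 : ℝ) 1) ∧
    ∃ h : Fin 3 → C(SG, ℝ), (∀ i, IsHarmonic (h i)) ∧
      ∀ i x, f (P i x) = d i * f x + h i x

open scoped Classical in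
/-- The graph Laplacian on `V m`. -/
def graphLaplacian (m : ℕ) (u : SG → ℝ) (x : SG) : ℝ :=
  ∑ y ∈ (V m).filter (fun y => Adj m x y), (u y - u x)

/-- `u` is in the domain of the Laplacian with `Δ u = g`: the renormalized graph Laplacians
`(3/2) 5ᵐ Δₘ u`, defined on `V m \ V 0`, converge uniformly to the continuous function `g`. -/
def HasLaplacian (u g : C(SG, ℝ)) : Prop :=
  ∀ ε : ℝ, 0 < ε → ∃ M : ℕ, ∀ m : ℕ, M ≤ m → ∀ x ∈ V m, x ∉ V 0 →
    |(3 / 2 : ℝ) * 5 ^ m * graphLaplacian m u x - g x| < ε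

/-- `u` solves the Dirichlet problem `u (q i) = a i`, `Δ u = η` on `SG \ V 0`. -/
def IsDirichletSolution (a : Fin 3 → ℝ) (η : ℝ) (u : C(SG, ℝ)) : Prop :=
  (∀ i, u (q i) = a i) ∧
    ∃ g : C(SG, ℝ), HasLaplacian u g ∧ ∀ x : SG, x ∉ V 0 → g x = η

/-- `u` is an FIF with uniform vertical scaling factor `1/5`, with the values `a i` at `q i` and
`(2 a i + 2 a j + a k - η / 3) / 5` at `q_{ij} = P i (q j)`, for `{i, j, k} = {0, 1, 2}`. -/
def IsDirichletFIF (a : Fin 3 → ℝ) (η : ℝ) (u : C(SG, ℝ)) : Prop :=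
  IsFIF (fun _ => 1 / 5) u ∧ (∀ i, u (q i) = a i) ∧
    ∀ i j k : Fin 3, i ≠ j → j ≠ k → i ≠ k →
      u (P i (q j)) = (2 * a i + 2 * a j + a k - η / 3) / 5

end SierpinskiGasket

end

noncomputable section

namespace SierpinskiGasket

/-! Every notion in the theorem reduces to one local condition, `CellRule η`: in each cell of level
`n`, the junction values of the next level are the harmonic 2-2-1 averages of the vertex values,
lowered by `η / (15 * 5 ^ n)`. Harmonicity is `CellRule 0`, because the energy gained in one
subdivision is a definite quadratic form in the deviations from the rule
(`graphEnergy_one_sub_zero`) and energy is self-similar. The FIF condition together with the rule at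
the top level is `CellRule η`, because the rule is linear in `(u, η)` and passing to a subcell
divides `η` by 5: thus `u ∘ P i - u / 5` obeys the rule with constant 0
(`cellRule_iff_isFIF_and_boundaryRule`). For the Laplacian, `CellRule η` makes `(3/2) 5ᵐ Δₘ u` equal
to `η` exactly, at every level (`CellRule.graphLaplacian_eq`). The converse is indirect:
`interpolant` is a solution obeying the rule, and the discrete maximum principle shows that it is
the only solution. The geometric input is that two different cells of level 1 meet in a single
junction point, which is read off from barycentric coordinates. -/

/-! ### Barycentric coordinates and the intersection of cells -/

/-- Barycentric coordinates of the plane with respect to the three vertices. -/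
def barycentric (i : Fin 3) (x : EuclideanSpace ℝ (Fin 2)) : ℝ :=
  ![1 - x 0 - x 1 / √3, x 0 - x 1 / √3, 2 * x 1 / √3] i

theorem continuous_barycentric (i : Fin 3) : Continuous (barycentric i) := by
  unfold barycentric
  fin_cases i <;> simp <;> fun_prop

theorem sum_barycentric (x : EuclideanSpace ℝ (Fin 2)) : ∑ i, barycentric i x = 1 := by
  simp [Fin.sum_univ_three, barycentric]
  ring

theorem barycentric_contraction (i j : Fin 3) (x : EuclideanSpace ℝ (Fin 2)) :
    barycentric j (contraction i x) = (barycentric j x + if i = j then 1 else 0) / 2 := by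
  have h : √3 ≠ 0 := by positivity
  fin_cases i <;> fin_cases j <;> simp [barycentric, contraction, vertex] <;> field_simp <;> ring

theorem barycentric_vertex (i j : Fin 3) :
    barycentric j (vertex i) = if i = j then 1 else 0 := by
  have h : √3 ≠ 0 := by positivity
  fin_cases i <;> fin_cases j <;> simp [barycentric, vertex] <;> field_simp <;> norm_num

theorem barycentric_injective {x y : EuclideanSpace ℝ (Fin 2)}
    (h : ∀ i, barycentric i x = barycentric i y) : x = y := by
  have h3 : √3 ≠ 0 := by positivity
  have h1 := h 1
  have h2 := h 2
  simp only [barycentric, Matrix.cons_val] at h1 h2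
  have e1 : x 1 = y 1 := by
    field_simp at h2
    linarith
  have e0 : x 0 = y 0 := by
    rw [e1] at h1
    linarith
  ext i
  fin_cases i
  · exact e0
  · exact e1

/-- The minimum `μ` over the compact gasket is attained at some `contraction i y`, where the
coordinate is at least `μ / 2`; hence `μ ≥ μ / 2`. -/
theorem barycentric_nonneg (j : Fin 3) (x : SG) : 0 ≤ barycentric j x := by
  obtain ⟨z, hz, hmin⟩ := gasket_isAttractor.isCompact.exists_isMinOn
    gasket_isAttractor.nonempty (continuous_barycentric j).continuousOn
  have hz' := hz
  rw [gasket_isAttractor.self_similar] at hz'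
  obtain ⟨i, y, hy, rfl⟩ := by simpa only [Set.mem_iUnion, Set.mem_image] using hz'
  have h1 := hmin hy
  have h2 := hmin x.2
  simp only [Set.mem_ofPred_eq] at h1 h2
  rw [barycentric_contraction] at h1 h2
  split_ifs at h1 h2 <;> linarith

theorem q_injective : Function.Injective q := by
  intro i j h
  have h1 := barycentric_vertex i i
  have h2 : vertex i = vertex j := congrArg Subtype.val h
  rw [h2, barycentric_vertex] at h1
  by_contra hne
  simp [Ne.symm hne] at h1

theorem P_injective (i : Fin 3) : Function.Injective (P i) := by
  intro x y h
  apply Subtype.ext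
  refine barycentric_injective fun j => ?_
  have h1 : contraction i x = contraction i y := congrArg Subtype.val h
  have h2 := barycentric_contraction i j x
  rw [h1, barycentric_contraction] at h2
  linarith

theorem eq_q_of_one_le_barycentric {x : SG} {j : Fin 3} (h : 1 ≤ barycentric j x) : x = q j := by
  apply Subtype.ext
  refine barycentric_injective fun k => ?_
  have hs := sum_barycentric x
  rw [Fin.sum_univ_three] at hs
  have h0 := barycentric_nonneg 0 x
  have h1 := barycentric_nonneg 1 x
  have h2 := barycentric_nonneg 2 x
  show _ = barycentric k (vertex j)
  rw [barycentric_vertex]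
  fin_cases j <;> fin_cases k <;> simp at h ⊢ <;> linarith

/-- The `j`-th coordinate is at least `1/2` on cell `j`, while on cell `i` it is half that of `x`.
So `x` has `j`-th coordinate at least 1. -/
theorem eq_q_of_P_eq_P {i j : Fin 3} (hij : i ≠ j) {x y : SG} (h : P i x = P j y) : x = q j := by
  apply eq_q_of_one_le_barycentric
  have h1 : contraction i x = contraction j y := congrArg Subtype.val h
  have h2 := barycentric_contraction i j x
  rw [h1, barycentric_contraction] at h2
  have := barycentric_nonneg j y
  simp [hij] at h2
  linarith

theorem P_q_self (i : Fin 3) : P i (q i) = q i := by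
  apply Subtype.ext
  show contraction i (vertex i) = vertex i
  unfold contraction
  module

theorem P_q_comm (i j : Fin 3) : P i (q j) = P j (q i) := by
  apply Subtype.ext
  show contraction i (vertex j) = contraction j (vertex i)
  unfold contraction
  module

theorem Pword_injective (w : List (Fin 3)) : Function.Injective (Pword w) := by
  induction w with
  | nil => exact Function.injective_id
  | cons i w ih => exact (P_injective i).comp ih

@[simp] theorem Pword_nil (x : SG) : Pword [] x = x := rfl

@[simp] theorem Pword_cons (i : Fin 3) (w : List (Fin 3)) (x : SG) :
    Pword (i :: w) x = P i (Pword w x) := rfl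

/-- An edge lies in exactly one cell of its level. -/
theorem edge_unique {w v : List (Fin 3)} (hl : w.length = v.length) {i j i' j' : Fin 3}
    (hij : i ≠ j) (hi : Pword w (q i) = Pword v (q i')) (hj : Pword w (q j) = Pword v (q j')) :
    w = v ∧ i = i' ∧ j = j' := by
  induction w generalizing v with
  | nil =>
    obtain rfl : v = [] := List.length_eq_zero_iff.1 hl.symm
    exact ⟨rfl, q_injective hi, q_injective hj⟩
  | cons l w ih =>
    obtain _ | ⟨l', v⟩ := v
    · simp at hl
    rw [Pword_cons, Pword_cons] at hi hj
    by_cases hll : l = l'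
    · subst hll
      obtain ⟨h1, h2⟩ := ih (by simpa using hl) (P_injective l hi) (P_injective l hj)
      exact ⟨by rw [h1], h2⟩
    -- Cells with different first letters share only one point, so both endpoints of the edge would
    -- coincide.
    · have h := (eq_q_of_P_eq_P hll hi).trans (eq_q_of_P_eq_P hll hj).symm
      exact absurd (q_injective (Pword_injective w h)) hij

/-! ### The vertex sets -/

theorem mem_V {m : ℕ} {x : SG} :
    x ∈ V m ↔ ∃ w : List (Fin 3), w.length = m ∧ ∃ i, x = Pword w (q i) := by
  simp only [V, Finset.mem_image, Finset.mem_univ, true_and, Prod.exists]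
  constructor
  · rintro ⟨w, i, rfl⟩
    exact ⟨List.ofFn w, List.length_ofFn, i, rfl⟩
  · rintro ⟨w, rfl, i, rfl⟩
    exact ⟨w.get, i, by rw [List.ofFn_get]⟩

theorem mem_V_zero {x : SG} : x ∈ V 0 ↔ ∃ i, x = q i := by
  rw [mem_V]
  constructor
  · rintro ⟨w, hw, i, rfl⟩
    obtain rfl := List.length_eq_zero_iff.1 hw
    exact ⟨i, rfl⟩
  · rintro ⟨i, rfl⟩
    exact ⟨[], rfl, i, rfl⟩

theorem q_mem_V (m : ℕ) (i : Fin 3) : q i ∈ V m := by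
  rw [mem_V]
  refine ⟨List.replicate m i, List.length_replicate, i, ?_⟩
  induction m with
  | zero => rfl
  | succ m ih => rw [List.replicate_succ, Pword_cons, ← ih, P_q_self]

theorem P_mem_V {m : ℕ} {x : SG} (i : Fin 3) (hx : x ∈ V m) : P i x ∈ V (m + 1) := by
  obtain ⟨w, rfl, j, rfl⟩ := mem_V.1 hx
  exact mem_V.2 ⟨i :: w, by simp, j, rfl⟩

theorem exists_of_mem_V_succ {m : ℕ} {x : SG} (hx : x ∈ V (m + 1)) :
    ∃ i, ∃ y ∈ V m, x = P i y := by
  obtain ⟨w, hw, j, rfl⟩ := mem_V.1 hx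
  obtain _ | ⟨i, w⟩ := w
  · simp at hw
  · exact ⟨i, _, mem_V.2 ⟨w, by simpa using hw, j, rfl⟩, rfl⟩

theorem V_subset_succ (m : ℕ) : V m ⊆ V (m + 1) := by
  induction m with
  | zero =>
    intro x hx
    obtain ⟨i, rfl⟩ := mem_V_zero.1 hx
    exact q_mem_V 1 i
  | succ m ih =>
    intro x hx
    obtain ⟨i, y, hy, rfl⟩ := exists_of_mem_V_succ hx
    exact P_mem_V i (ih hy)

theorem V_mono : Monotone V := monotone_nat_of_le_succ V_subset_succ

/-! ### Sums over the edges as sums over the cells -/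

open scoped Classical in
/-- The sum of `F x y` over the pairs of vertices `x, y` of a common cell of level `m`. -/
def cellSum (m : ℕ) (F : SG → SG → ℝ) (x : SG) : ℝ :=
  ∑ w : Fin m → Fin 3, ∑ i, ∑ j,
    if Pword (List.ofFn w) (q i) = x then F x (Pword (List.ofFn w) (q j)) else 0

open scoped Classical in
-- By `edge_unique`, a neighbour of `x` corresponds to exactly one triple (cell, index of `x`, index
-- of the neighbour); the diagonal terms of `cellSum` vanish by `hF`. Sums over cells, unlike sums
-- over edges, split along the first letter.
theorem sum_adj_eq_cellSum (m : ℕ) {F : SG → SG → ℝ} (hF : ∀ x, F x x = 0) (x : SG) :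
    ∑ y ∈ (V m).filter (fun y => Adj m x y), F x y = cellSum m F x := by
  have h1 : cellSum m F x = ∑ t : (Fin m → Fin 3) × Fin 3 × Fin 3 with
      Pword (List.ofFn t.1) (q t.2.1) = x ∧ t.2.1 ≠ t.2.2,
        F x (Pword (List.ofFn t.1) (q t.2.2)) := by
    rw [Finset.sum_filter, cellSum, Fintype.sum_prod_type]
    refine Finset.sum_congr rfl fun w _ => ?_
    rw [Fintype.sum_prod_type]
    refine Finset.sum_congr rfl fun i _ => Finset.sum_congr rfl fun j _ => ?_
    by_cases hx : Pword (List.ofFn w) (q i) = x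
    · by_cases hij : i = j
      · subst hij
        simp [hx, hF]
      · simp [hx, hij]
    · simp [hx]
  rw [h1]
  symm
  refine Finset.sum_nbij (fun t => Pword (List.ofFn t.1) (q t.2.2)) ?_ ?_ ?_ (fun _ _ => rfl)
  · rintro ⟨w, i, j⟩ ht
    obtain ⟨rfl, hij⟩ := (Finset.mem_filter.1 ht).2
    refine Finset.mem_filter.2 ⟨mem_V.2 ⟨_, List.length_ofFn, j, rfl⟩, ?_, List.ofFn w,
      List.length_ofFn, ⟨i, rfl⟩, ⟨j, rfl⟩⟩
    exact fun h => hij (q_injective (Pword_injective _ h))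
  · rintro ⟨w, i, j⟩ ht ⟨w', i', j'⟩ ht' h
    obtain ⟨hx, hij⟩ := (Finset.mem_filter.1 ht).2
    obtain ⟨hx', -⟩ := (Finset.mem_filter.1 ht').2
    obtain ⟨hw, rfl, rfl⟩ := edge_unique (by simp) hij (hx.trans hx'.symm) h
    exact Prod.ext (List.ofFn_injective hw) rfl
  · intro y hy
    obtain ⟨-, hne, w, rfl, ⟨i, rfl⟩, ⟨j, rfl⟩⟩ := Finset.mem_filter.1 hy
    refine ⟨⟨w.get, i, j⟩, ?_, ?_⟩
    · simp only [Finset.coe_filter, Finset.mem_univ, true_and, Set.mem_ofPred_eq, List.ofFn_get]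
      exact fun h => hne (by rw [h])
    · simp only [List.ofFn_get]

theorem graphLaplacian_eq_cellSum (m : ℕ) (u : SG → ℝ) (x : SG) :
    graphLaplacian m u x = cellSum m (fun x y => u y - u x) x :=
  sum_adj_eq_cellSum m (F := fun x y => u y - u x) (fun _ => sub_self _) x

/-- The graph energy as a sum over the cells. -/
theorem graphEnergy_eq_sum (m : ℕ) (u : SG → ℝ) :
    graphEnergy m u = (5 / 3 : ℝ) ^ m * ((1 / 2 : ℝ) * ∑ w : Fin m → Fin 3, ∑ i, ∑ j,
      (u (Pword (List.ofFn w) (q i)) - u (Pword (List.ofFn w) (q j))) ^ 2) := by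
  classical
  unfold graphEnergy
  congr 2
  calc _ = ∑ x ∈ V m, cellSum m (fun x y => (u x - u y) ^ 2) x :=
        Finset.sum_congr rfl fun x _ =>
          sum_adj_eq_cellSum m (F := fun x y => (u x - u y) ^ 2) (fun _ => by simp) x
    _ = _ := by
        unfold cellSum
        rw [Finset.sum_comm]
        refine Finset.sum_congr rfl fun w _ => ?_
        rw [Finset.sum_comm]
        refine Finset.sum_congr rfl fun i _ => ?_
        rw [Finset.sum_comm]
        refine Finset.sum_congr rfl fun j _ => ?_
        rw [Finset.sum_ite_eq, if_pos (mem_V.2 ⟨_, List.length_ofFn, i, rfl⟩)]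

theorem sum_words_succ {m : ℕ} (G : List (Fin 3) → ℝ) :
    ∑ w : Fin (m + 1) → Fin 3, G (List.ofFn w) =
      ∑ l, ∑ w : Fin m → Fin 3, G (l :: List.ofFn w) := by
  rw [← (Fin.consEquiv fun _ : Fin (m + 1) => Fin 3).sum_comp, Fintype.sum_prod_type]
  simp [Fin.consEquiv, List.ofFn_succ]

theorem graphEnergy_succ (m : ℕ) (u : SG → ℝ) :
    graphEnergy (m + 1) u = 5 / 3 * ∑ l, graphEnergy m (u ∘ P l) := by
  simp only [graphEnergy_eq_sum]
  rw [sum_words_succ fun w => ∑ i, ∑ j, (u (Pword w (q i)) - u (Pword w (q j))) ^ 2,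
    ← Finset.mul_sum, ← Finset.mul_sum]
  simp only [Pword_cons, Function.comp_apply]
  ring

open scoped Classical in
theorem graphLaplacian_succ (m : ℕ) (u : SG → ℝ) (x : SG) :
    graphLaplacian (m + 1) u x = ∑ l, ∑ w : Fin m → Fin 3, ∑ i, ∑ j,
      if P l (Pword (List.ofFn w) (q i)) = x then
        u (P l (Pword (List.ofFn w) (q j))) - u x else 0 := by
  rw [graphLaplacian_eq_cellSum, cellSum,
    sum_words_succ fun w => ∑ i, ∑ j, if Pword w (q i) = x then u (Pword w (q j)) - u x else 0]
  rfl

open scoped Classical in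
/-- The contribution of the cell `P l '' SG` to the graph Laplacian at `P l y`. -/
theorem graphLaplacian_comp_P (m : ℕ) (u : SG → ℝ) (l : Fin 3) (y : SG) :
    graphLaplacian m (u ∘ P l) y = ∑ w : Fin m → Fin 3, ∑ i, ∑ j,
      if P l (Pword (List.ofFn w) (q i)) = P l y then
        u (P l (Pword (List.ofFn w) (q j))) - u (P l y) else 0 := by
  rw [graphLaplacian_eq_cellSum, cellSum]
  simp only [(P_injective l).eq_iff, Function.comp_apply]

/-- Away from the junction points, only the cell `l` of level 1 contains `P l y`, so the other cells
contribute nothing. -/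
theorem graphLaplacian_succ_P {m : ℕ} (u : SG → ℝ) {l : Fin 3} {y : SG}
    (hy : ∀ l', l' ≠ l → y ≠ q l') :
    graphLaplacian (m + 1) u (P l y) = graphLaplacian m (u ∘ P l) y := by
  classical
  rw [graphLaplacian_succ, graphLaplacian_comp_P]
  refine Finset.sum_eq_single l (fun l' _ hl => ?_) (by simp)
  refine Finset.sum_eq_zero fun w _ => Finset.sum_eq_zero fun i _ => Finset.sum_eq_zero fun j _ => ?_
  exact if_neg fun h => hy l' hl (eq_q_of_P_eq_P hl.symm h.symm)

theorem graphLaplacian_succ_junction {m : ℕ} (u : SG → ℝ) {i j : Fin 3} (hij : i ≠ j) :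
    graphLaplacian (m + 1) u (P i (q j)) =
      graphLaplacian m (u ∘ P i) (q j) + graphLaplacian m (u ∘ P j) (q i) := by
  classical
  rw [graphLaplacian_comp_P m u j, P_q_comm j i, graphLaplacian_comp_P, graphLaplacian_succ]
  refine Finset.sum_eq_add i j hij (fun l _ hl => ?_) (by simp) (by simp)
  refine Finset.sum_eq_zero fun w _ => Finset.sum_eq_zero fun i' _ =>
    Finset.sum_eq_zero fun j' _ => ?_
  exact if_neg fun h => hl.2 (q_injective (eq_q_of_P_eq_P hl.1.symm h.symm)).symm

theorem graphLaplacian_zero_q (u : SG → ℝ) (i : Fin 3) :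
    graphLaplacian 0 u (q i) = ∑ j, (u (q j) - u (q i)) := by
  rw [graphLaplacian_eq_cellSum, cellSum]
  simp [q_injective.eq_iff]

theorem graphEnergy_zero (u : SG → ℝ) :
    graphEnergy 0 u = 1 / 2 * ∑ i, ∑ j, (u (q i) - u (q j)) ^ 2 := by
  rw [graphEnergy_eq_sum]
  simp

/-! ### The interpolation rule -/

/-- The values of `u` at the junction points `P i (q j)` are those prescribed by the values at the
boundary and by `η`. -/
def BoundaryRule (η : ℝ) (u : SG → ℝ) : Prop :=
  ∀ i j k : Fin 3, i ≠ j → j ≠ k → i ≠ k →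
    u (P i (q j)) = (2 * u (q i) + 2 * u (q j) + u (q k) - η / 3) / 5

/-- The rule `BoundaryRule` holds in all cells, with `η` scaled by `1 / 5` from each level to the
next. -/
def CellRule (η : ℝ) (u : SG → ℝ) : Prop :=
  ∀ w : List (Fin 3), BoundaryRule (η / 5 ^ w.length) (u ∘ Pword w)

theorem CellRule.boundaryRule {η : ℝ} {u : SG → ℝ} (h : CellRule η u) : BoundaryRule η u := by
  simpa [Pword] using h []

theorem CellRule.comp_P {η : ℝ} {u : SG → ℝ} (h : CellRule η u) (i : Fin 3) :
    CellRule (η / 5) (u ∘ P i) := by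
  intro w
  have := h (i :: w)
  rwa [List.length_cons, pow_succ', ← div_div] at this

theorem BoundaryRule.sub {η θ : ℝ} {u v : SG → ℝ} (hu : BoundaryRule η u)
    (hv : BoundaryRule θ v) : BoundaryRule (η - θ) (u - v) := by
  intro i j k hij hjk hik
  simp only [Pi.sub_apply, hu i j k hij hjk hik, hv i j k hij hjk hik]
  ring

theorem BoundaryRule.smul {η : ℝ} {u : SG → ℝ} (hu : BoundaryRule η u) (c : ℝ) :
    BoundaryRule (c * η) (c • u) := by
  intro i j k hij hjk hik
  simp only [Pi.smul_apply, smul_eq_mul, hu i j k hij hjk hik]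
  ring

theorem CellRule.sub {η θ : ℝ} {u v : SG → ℝ} (hu : CellRule η u) (hv : CellRule θ v) :
    CellRule (η - θ) (u - v) := by
  intro w
  rw [sub_div]
  exact (hu w).sub (hv w)

theorem CellRule.smul {η : ℝ} {u : SG → ℝ} (hu : CellRule η u) (c : ℝ) :
    CellRule (c * η) (c • u) := by
  intro w
  rw [mul_div_assoc]
  exact (hu w).smul c

theorem BoundaryRule.junction_values {η : ℝ} {u : SG → ℝ} (h : BoundaryRule η u) :
    (u (P 0 (q 1)) = (2 * u (q 0) + 2 * u (q 1) + u (q 2) - η / 3) / 5 ∧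
    u (P 0 (q 2)) = (2 * u (q 0) + 2 * u (q 2) + u (q 1) - η / 3) / 5 ∧
    u (P 1 (q 2)) = (2 * u (q 1) + 2 * u (q 2) + u (q 0) - η / 3) / 5) :=
  ⟨h 0 1 2 (by decide) (by decide) (by decide), h 0 2 1 (by decide) (by decide) (by decide),
    h 1 2 0 (by decide) (by decide) (by decide)⟩

/-! ### The graph Laplacian of a function that satisfies the interpolation rule -/

/-- One subdivision sends the sum `S` of differences at `q i` to `(3/5) S - 2η/15`. Iterating with
`η` divided by 5 each time produces a geometric sum, which is the second term. -/
theorem CellRule.graphLaplacian_q {η : ℝ} {u : SG → ℝ} (h : CellRule η u) (m : ℕ) (i : Fin 3) :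
    graphLaplacian m u (q i) = (3 / 5) ^ m * ∑ j, (u (q j) - u (q i)) -
      η / 3 * ((3 / 5) ^ m - (1 / 5) ^ m) := by
  induction m generalizing η u with
  | zero => simp [graphLaplacian_zero_q]
  | succ m ih =>
    have hq : graphLaplacian (m + 1) u (q i) = graphLaplacian m (u ∘ P i) (q i) := by
      conv_lhs => rw [← P_q_self i]
      exact graphLaplacian_succ_P u fun l hl hq => hl (q_injective hq).symm
    obtain ⟨h01, h02, h12⟩ := h.boundaryRule.junction_values
    rw [hq, ih (h.comp_P i)]
    have h10 := P_q_comm 1 0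
    have h20 := P_q_comm 2 0
    have h21 := P_q_comm 2 1
    fin_cases i <;>
      simp [Fin.sum_univ_three, P_q_self, h10, h20, h21, h01, h02, h12] <;> ring

theorem BoundaryRule.graphLaplacian_one {η : ℝ} {u : SG → ℝ} (h : BoundaryRule η u) {i j : Fin 3}
    (hij : i ≠ j) :
    ∑ l, (u (P i (q l)) - u (P i (q j))) + ∑ l, (u (P j (q l)) - u (P j (q i))) = 2 * η / 15 := by
  obtain ⟨h01, h02, h12⟩ := h.junction_values
  have h10 := P_q_comm 1 0
  have h20 := P_q_comm 2 0
  have h21 := P_q_comm 2 1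
  fin_cases i <;> fin_cases j <;> simp at hij <;>
    simp [Fin.sum_univ_three, P_q_self, h10, h20, h21, h01, h02, h12] <;> ring

/-- The renormalized graph Laplacians of a function that satisfies the interpolation rule are
constant. -/
theorem CellRule.graphLaplacian_eq {η : ℝ} {u : SG → ℝ} (h : CellRule η u) {m : ℕ} {x : SG}
    (hx : x ∈ V m) (hx0 : x ∉ V 0) : graphLaplacian m u x = 2 / 3 * (1 / 5) ^ m * η := by
  induction m generalizing η u x with
  | zero => exact absurd hx hx0
  | succ m ih =>
    obtain ⟨l, y, hy, rfl⟩ := exists_of_mem_V_succ hx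
    by_cases hy0 : y ∈ V 0
    · obtain ⟨j, rfl⟩ := mem_V_zero.1 hy0
      have hlj : l ≠ j := by
        rintro rfl
        exact hx0 (by rwa [P_q_self])
      rw [graphLaplacian_succ_junction u hlj, (h.comp_P l).graphLaplacian_q,
        (h.comp_P j).graphLaplacian_q]
      have := h.boundaryRule.graphLaplacian_one hlj
      simp only [Function.comp_apply]
      -- The terms in `(3/5) ^ m` cancel: the level-one Laplacian gives `2η/15`, and the two
      -- one-sided corrections remove exactly that amount. Only the `(1/5) ^ m` part survives.
      linear_combination (3 / 5 : ℝ) ^ m * this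
    · rw [graphLaplacian_succ_P u fun l' _ hl => hy0 (mem_V_zero.2 ⟨l', hl⟩),
        ih (h.comp_P l) hy hy0]
      ring

theorem CellRule.hasLaplacian {η : ℝ} {u g : C(SG, ℝ)} (h : CellRule η u)
    (hg : ∀ x, x ∉ V 0 → g x = η) : HasLaplacian u g := by
  intro ε hε
  refine ⟨0, fun m _ x hx hx0 => ?_⟩
  rw [h.graphLaplacian_eq hx hx0, hg x hx0]
  have h5 : (5 : ℝ) ^ m * (1 / 5) ^ m = 1 := by rw [← mul_pow]; norm_num
  have : (3 / 2 : ℝ) * 5 ^ m * (2 / 3 * (1 / 5) ^ m * η) - η = 0 := by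
    linear_combination η * h5
  rwa [this, abs_zero]

theorem CellRule.isDirichletSolution {a : Fin 3 → ℝ} {η : ℝ} {u : C(SG, ℝ)} (h : CellRule η u)
    (ha : ∀ i, u (q i) = a i) : IsDirichletSolution a η u :=
  ⟨ha, ContinuousMap.const _ η, h.hasLaplacian fun _ _ => rfl, fun _ _ => rfl⟩

/-! ### Harmonic functions -/

/-- The energy gained in the first subdivision is a positive definite quadratic form in the
deviations from the interpolation rule. -/
theorem graphEnergy_one_sub_zero (u : SG → ℝ) {d : Fin 3 → ℝ}
    (h0 : d 0 = u (P 1 (q 2)) - (2 * u (q 1) + 2 * u (q 2) + u (q 0)) / 5)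
    (h1 : d 1 = u (P 0 (q 2)) - (2 * u (q 0) + 2 * u (q 2) + u (q 1)) / 5)
    (h2 : d 2 = u (P 0 (q 1)) - (2 * u (q 0) + 2 * u (q 1) + u (q 2)) / 5) :
    graphEnergy 1 u - graphEnergy 0 u = 5 / 3 * (2 * (d 0 ^ 2 + d 1 ^ 2 + d 2 ^ 2) +
      (d 0 - d 1) ^ 2 + (d 1 - d 2) ^ 2 + (d 0 - d 2) ^ 2) := by
  rw [graphEnergy_succ]
  simp only [graphEnergy_zero, Fin.sum_univ_three, Function.comp_apply, P_q_self, P_q_comm 1 0,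
    P_q_comm 2 0, P_q_comm 2 1, h0, h1, h2]
  ring

theorem graphEnergy_zero_le_one (u : SG → ℝ) : graphEnergy 0 u ≤ graphEnergy 1 u := by
  rw [← sub_nonneg, graphEnergy_one_sub_zero u
    (d := ![_, _, _]) rfl rfl rfl]
  positivity

theorem graphEnergy_zero_eq_one_iff (u : SG → ℝ) :
    graphEnergy 0 u = graphEnergy 1 u ↔ BoundaryRule 0 u := by
  have key := graphEnergy_one_sub_zero u (d := ![_, _, _]) rfl rfl rfl
  simp only [Matrix.cons_val] at key
  constructor
  · intro h
    rw [h, sub_self] at key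
    have e (x y z : ℝ) (h : 0 = 5 / 3 * (2 * (x ^ 2 + y ^ 2 + z ^ 2) + (x - y) ^ 2 + (y - z) ^ 2 +
        (x - z) ^ 2)) : x = 0 ∧ y = 0 ∧ z = 0 := by
      refine ⟨?_, ?_, ?_⟩ <;> apply pow_eq_zero_iff two_ne_zero |>.1 <;>
        linarith [sq_nonneg x, sq_nonneg y, sq_nonneg z, sq_nonneg (x - y), sq_nonneg (y - z),
          sq_nonneg (x - z)]
    obtain ⟨h0, h1, h2⟩ := e _ _ _ key
    have h10 := P_q_comm 1 0
    have h20 := P_q_comm 2 0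
    have h21 := P_q_comm 2 1
    intro i j k hij hjk hik
    fin_cases i <;> fin_cases j <;> simp at hij <;> fin_cases k <;> simp at hik hjk <;>
      simp only [Fin.zero_eta, Fin.mk_one, Fin.reduceFinMk, h10, h20, h21] <;> linarith
  · intro h
    obtain ⟨h01, h02, h12⟩ := h.junction_values
    rw [h01, h02, h12] at key
    ring_nf at key
    linarith

theorem graphEnergy_le_succ (m : ℕ) (u : SG → ℝ) : graphEnergy m u ≤ graphEnergy (m + 1) u := by
  induction m generalizing u with
  | zero => exact graphEnergy_zero_le_one u
  | succ m ih =>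
    rw [graphEnergy_succ (m + 1), graphEnergy_succ m]
    gcongr
    exact ih _

/-- Energy cannot decrease in any cell, so equality of the sums forces equality cell by cell. -/
theorem graphEnergy_succ_eq_iff (m : ℕ) (u : SG → ℝ) :
    graphEnergy (m + 1) u = graphEnergy (m + 2) u ↔
      ∀ i, graphEnergy m (u ∘ P i) = graphEnergy (m + 1) (u ∘ P i) := by
  rw [graphEnergy_succ (m + 1), graphEnergy_succ m, mul_right_inj' (by norm_num),
    Finset.sum_eq_sum_iff_of_le fun i _ => graphEnergy_le_succ m _]
  simp

theorem graphEnergy_const_iff_cellRule (u : SG → ℝ) :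
    (∀ m, graphEnergy m u = graphEnergy (m + 1) u) ↔ CellRule 0 u := by
  constructor
  · intro h w
    induction w generalizing u with
    | nil => simpa [Pword] using (graphEnergy_zero_eq_one_iff u).1 (h 0)
    | cons i w ih =>
      have := ih (u ∘ P i) fun m => (graphEnergy_succ_eq_iff m u).1 (h (m + 1)) i
      rw [zero_div] at this ⊢
      exact this
  · intro h m
    induction m generalizing u with
    | zero => exact (graphEnergy_zero_eq_one_iff u).2 h.boundaryRule
    | succ m ih =>
      refine (graphEnergy_succ_eq_iff m u).2 fun i => ih _ ?_
      simpa using h.comp_P i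

theorem isHarmonic_iff_cellRule (u : C(SG, ℝ)) : IsHarmonic u ↔ CellRule 0 u :=
  graphEnergy_const_iff_cellRule u

/-! ### Fractal interpolation functions -/

theorem continuous_P (i : Fin 3) : Continuous (P i) := by
  unfold P contraction
  fun_prop

/-- The scaling factor `1/5` matches the factor by which `η` shrinks, so `η` drops out of `u ∘ P i -
u / 5`. Conversely, the rule for `u` in cell `w` and for `h i` in cell `w` add up to the rule for
`u` in cell `i :: w`. -/
theorem cellRule_iff_isFIF_and_boundaryRule (η : ℝ) (u : C(SG, ℝ)) :
    CellRule η u ↔ IsFIF (fun _ => 1 / 5) u ∧ BoundaryRule η u := by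
  constructor
  · intro h
    refine ⟨⟨fun _ => by norm_num,
      fun i => u.comp ⟨P i, continuous_P i⟩ - (1 / 5 : ℝ) • u, fun i => ?_, fun i x => ?_⟩,
      h.boundaryRule⟩
    · rw [isHarmonic_iff_cellRule]
      have := (h.comp_P i).sub (h.smul (1 / 5))
      rwa [show η / 5 - 1 / 5 * η = 0 by ring] at this
    · simp
  · rintro ⟨⟨-, h, hh, hu⟩, hb⟩ w
    induction w with
    | nil => simpa [Pword] using hb
    | cons i w ih =>
      have hi := (isHarmonic_iff_cellRule _).1 (hh i) w
      intro j k l hjk hkl hjl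
      have h1 := ih j k l hjk hkl hjl
      have h2 := hi j k l hjk hkl hjl
      simp only [Function.comp_apply, Pword_cons, hu, List.length_cons] at h1 h2 ⊢
      rw [h1, h2, pow_succ]
      ring

theorem isDirichletFIF_iff_cellRule (a : Fin 3 → ℝ) (η : ℝ) (u : C(SG, ℝ)) :
    IsDirichletFIF a η u ↔ CellRule η u ∧ ∀ i, u (q i) = a i := by
  rw [cellRule_iff_isFIF_and_boundaryRule, IsDirichletFIF, BoundaryRule]
  constructor
  · rintro ⟨h1, h2, h3⟩
    exact ⟨⟨h1, by simpa only [h2] using h3⟩, h2⟩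
  · rintro ⟨⟨h1, h3⟩, h2⟩
    exact ⟨h1, h2, by simpa only [h2] using h3⟩

/-! ### Existence: values along addresses -/

/-- The values at the vertices of the subcell `i` prescribed by the interpolation rule. -/
def subcell (b : Fin 3 → ℝ) (η : ℝ) (i j : Fin 3) : ℝ :=
  -- Adding the full sum to `b i + b j` gives the weights 2, 2, 1 without naming the third index.
  if j = i then b i else (b i + b j + ∑ k, b k - η / 3) / 5

theorem subcell_self (b : Fin 3 → ℝ) (η : ℝ) (i : Fin 3) : subcell b η i i = b i := if_pos rfl

theorem subcell_comm (b : Fin 3 → ℝ) (η : ℝ) (i j : Fin 3) :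
    subcell b η i j = subcell b η j i := by
  unfold subcell
  by_cases h : i = j
  · rw [h]
  · rw [if_neg h, if_neg (Ne.symm h), add_comm (b i)]

/-- The value at the vertex `0` of the cell of level `n` that is determined by the address `ω`. -/
def approx : ℕ → (Fin 3 → ℝ) → ℝ → (ℕ → Fin 3) → ℝ
  | 0, b, _, _ => b 0
  | n + 1, b, η, ω => approx n (subcell b η (ω 0)) (η / 5) fun k => ω (k + 1)

/-- A bound for the oscillation of the boundary values and for `η`. -/
def OscBound (K : ℝ) (b : Fin 3 → ℝ) (η : ℝ) : Prop := ∀ i j, |b i - b j| + |η| ≤ K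

theorem exists_oscBound (b : Fin 3 → ℝ) (η : ℝ) : ∃ K, OscBound K b η := by
  refine ⟨∑ p : Fin 3 × Fin 3, |b p.1 - b p.2| + |η|, fun i j => ?_⟩
  gcongr
  exact Finset.single_le_sum (f := fun p : Fin 3 × Fin 3 => |b p.1 - b p.2|)
    (fun p _ => abs_nonneg _) (Finset.mem_univ (i, j))

/-- The rule shrinks differences by `3/5` up to an error `|η| / 15`. Carrying `|η|` in the bound
absorbs this error, since `1/15 + 1/5 ≤ 3/5`. -/
theorem OscBound.subcell {K : ℝ} {b : Fin 3 → ℝ} {η : ℝ} (h : OscBound K b η) (l : Fin 3) :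
    OscBound (3 / 5 * K) (subcell b η l) (η / 5) := by
  intro i j
  have h01 := h 0 1
  have h02 := h 0 2
  have h12 := h 1 2
  have e1 := abs_le.1 (le_sub_iff_add_le.2 h01)
  have e2 := abs_le.1 (le_sub_iff_add_le.2 h02)
  have e3 := abs_le.1 (le_sub_iff_add_le.2 h12)
  have e4 := neg_abs_le η
  have e5 := le_abs_self η
  have e6 := abs_nonneg η
  rw [abs_div, abs_of_pos (by norm_num : (0 : ℝ) < 5), ← le_sub_iff_add_le, abs_le]
  fin_cases l <;> fin_cases i <;> fin_cases j <;>
    simp only [SierpinskiGasket.subcell, Fin.sum_univ_three, Fin.zero_eta, Fin.mk_one,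
      Fin.reduceFinMk, Fin.reduceEq, if_true, if_false] <;> constructor <;> linarith

theorem OscBound.abs_subcell_zero_sub_le {K : ℝ} {b : Fin 3 → ℝ} {η : ℝ} (h : OscBound K b η)
    (l : Fin 3) : |SierpinskiGasket.subcell b η l 0 - b 0| ≤ K := by
  have h01 := h 0 1
  have h02 := h 0 2
  have h12 := h 1 2
  have e1 := abs_le.1 (le_sub_iff_add_le.2 h01)
  have e2 := abs_le.1 (le_sub_iff_add_le.2 h02)
  have e3 := abs_le.1 (le_sub_iff_add_le.2 h12)
  have e4 := neg_abs_le η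
  have e5 := le_abs_self η
  have e6 := abs_nonneg η
  rw [abs_le]
  fin_cases l <;>
    simp only [SierpinskiGasket.subcell, Fin.sum_univ_three, Fin.zero_eta, Fin.mk_one,
      Fin.reduceFinMk, Fin.reduceEq, if_true, if_false] <;> constructor <;> linarith

theorem OscBound.abs_approx_succ_sub_le {K : ℝ} {b : Fin 3 → ℝ} {η : ℝ} (h : OscBound K b η)
    (n : ℕ) (ω : ℕ → Fin 3) : |approx (n + 1) b η ω - approx n b η ω| ≤ K * (3 / 5) ^ n := by
  induction n generalizing K b η ω with
  | zero => simpa [approx] using h.abs_subcell_zero_sub_le (ω 0)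
  | succ n ih =>
    have := ih (h.subcell (ω 0)) fun k => ω (k + 1)
    rw [pow_succ]
    simp only [approx] at this ⊢
    linarith

theorem continuous_approx (n : ℕ) (b : Fin 3 → ℝ) (η : ℝ) : Continuous (approx n b η) := by
  induction n generalizing b η with
  | zero => exact continuous_const
  | succ n ih =>
    have h : Continuous fun p : Fin 3 × (ℕ → Fin 3) => approx n (subcell b η p.1) (η / 5) p.2 :=
      continuous_prod_of_discrete_left.2 fun i => ih (subcell b η i) (η / 5)
    have hsplit : Continuous fun ω : ℕ → Fin 3 => (ω 0, fun k => ω (k + 1)) := by fun_prop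
    exact h.comp hsplit

/-- The value at the point with address `ω`, for the boundary values `b`. -/
def addressValue (b : Fin 3 → ℝ) (η : ℝ) (ω : ℕ → Fin 3) : ℝ :=
  b 0 + ∑' n, (approx (n + 1) b η ω - approx n b η ω)

theorem summable_bound (K : ℝ) : Summable fun n : ℕ => K * (3 / 5 : ℝ) ^ n :=
  (summable_geometric_of_lt_one (by norm_num) (by norm_num)).mul_left K

theorem continuous_addressValue (b : Fin 3 → ℝ) (η : ℝ) : Continuous (addressValue b η) := by
  obtain ⟨K, hK⟩ := exists_oscBound b η
  exact continuous_const.add (continuous_tsum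
    (fun n => (continuous_approx (n + 1) b η).sub (continuous_approx n b η)) (summable_bound K)
    fun n ω => hK.abs_approx_succ_sub_le n ω)

theorem tendsto_approx (b : Fin 3 → ℝ) (η : ℝ) (ω : ℕ → Fin 3) :
    Filter.Tendsto (fun n => approx n b η ω) Filter.atTop (nhds (addressValue b η ω)) := by
  obtain ⟨K, hK⟩ := exists_oscBound b η
  have hs : Summable fun n => approx (n + 1) b η ω - approx n b η ω :=
    Summable.of_norm_bounded (summable_bound K) fun n => hK.abs_approx_succ_sub_le n ω
  have := hs.hasSum.tendsto_sum_nat.const_add (b 0)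
  simp only [Finset.sum_range_sub (fun n => approx n b η ω)] at this
  simpa [approx, addressValue] using this

theorem addressValue_eq (b : Fin 3 → ℝ) (η : ℝ) (ω : ℕ → Fin 3) :
    addressValue b η ω = addressValue (subcell b η (ω 0)) (η / 5) fun k => ω (k + 1) :=
  tendsto_nhds_unique ((tendsto_approx b η ω).comp (Filter.tendsto_add_atTop_nat 1))
    (tendsto_approx (subcell b η (ω 0)) (η / 5) fun k => ω (k + 1))

/-- The constant is `5/2 + 1`: the geometric series of ratio `3/5` bounds the distance to `b 0`, and
`|b 0 - b i| ≤ K`. -/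
theorem OscBound.abs_addressValue_sub_le {K : ℝ} {b : Fin 3 → ℝ} {η : ℝ} (h : OscBound K b η)
    (ω : ℕ → Fin 3) (i : Fin 3) : |addressValue b η ω - b i| ≤ 7 / 2 * K := by
  have h1 : |∑' n, (approx (n + 1) b η ω - approx n b η ω)| ≤ 5 / 2 * K := by
    refine tsum_of_norm_bounded (f := fun n => approx (n + 1) b η ω - approx n b η ω) ?_
      fun n => h.abs_approx_succ_sub_le n ω
    have := (hasSum_geometric_of_lt_one (r := (3 / 5 : ℝ)) (by norm_num) (by norm_num)).mul_left K
    rwa [show K * (1 - 3 / 5 : ℝ)⁻¹ = 5 / 2 * K by ring] at this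
  have h2 := h 0 i
  have h3 := abs_nonneg η
  have h4 := abs_add_le (∑' n, (approx (n + 1) b η ω - approx n b η ω)) (b 0 - b i)
  rw [addressValue, show ∀ x : ℝ, b 0 + x - b i = x + (b 0 - b i) by intro x; ring]
  linarith

/-- Zooming into the corner `i` keeps the value `b i` and multiplies the oscillation bound by `3/5`,
so the error is below every `7/2 * K * (3/5) ^ n`. -/
theorem addressValue_const (b : Fin 3 → ℝ) (η : ℝ) (i : Fin 3) :
    addressValue b η (fun _ => i) = b i := by
  obtain ⟨K, hK⟩ := exists_oscBound b η
  have key : ∀ n : ℕ, |addressValue b η (fun _ => i) - b i| ≤ 7 / 2 * K * (3 / 5) ^ n := by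
    intro n
    induction n generalizing K b η with
    | zero => simpa using hK.abs_addressValue_sub_le _ i
    | succ n ih =>
      have := ih _ _ _ (hK.subcell i)
      rw [subcell_self] at this
      rw [addressValue_eq, pow_succ]
      linarith
  have ht : Filter.Tendsto (fun n : ℕ => 7 / 2 * K * (3 / 5 : ℝ) ^ n) Filter.atTop (nhds 0) := by
    simpa using (tendsto_pow_atTop_nhds_zero_of_lt_one (by norm_num : (0 : ℝ) ≤ 3 / 5)
      (by norm_num)).const_mul (7 / 2 * K)
  have := ge_of_tendsto' ht key
  exact sub_eq_zero.1 (abs_nonpos_iff.1 this)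

/-- The point of `SG` with address `ω`. -/
def address (ω : ℕ → Fin 3) : SG := ⟨addressPoint ω, ω, rfl⟩

theorem address_eq (ω : ℕ → Fin 3) : address ω = P (ω 0) (address fun k => ω (k + 1)) :=
  Subtype.ext (addressPoint_eq ω)

theorem address_surjective : Function.Surjective address := by
  rintro ⟨_, ω, rfl⟩
  exact ⟨ω, rfl⟩

/-- This lets a continuous function of the address descend to `SG` as soon as it is constant on the
fibres. -/
theorem isQuotientMap_address : Topology.IsQuotientMap address :=
  (continuous_addressPoint.subtype_mk _).isClosedMap.isQuotientMap
    (continuous_addressPoint.subtype_mk _) address_surjective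

theorem eq_const_of_address_eq_q {ω : ℕ → Fin 3} {i : Fin 3} (h : address ω = q i) :
    ω = fun _ => i := by
  funext n
  induction n generalizing ω with
  | zero =>
    by_contra hne
    rw [address_eq, ← P_q_self i] at h
    exact hne (q_injective (eq_q_of_P_eq_P (Ne.symm hne) h.symm)).symm
  | succ n ih =>
    rw [address_eq, ← P_q_self i] at h
    by_cases h0 : ω 0 = i
    · rw [h0] at h
      exact ih (P_injective i h)
    · exact absurd (q_injective (eq_q_of_P_eq_P (Ne.symm h0) h.symm)).symm h0

/-- Such a point is a junction point: past the first letter, each address is constant, equal to the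
first letter of the other. The two values agree because `subcell` is symmetric. -/
theorem addressValue_congr_of_ne {b : Fin 3 → ℝ} {η : ℝ} {ω ω' : ℕ → Fin 3}
    (h : address ω = address ω') (h0 : ω 0 ≠ ω' 0) :
    addressValue b η ω = addressValue b η ω' := by
  rw [address_eq ω, address_eq ω'] at h
  have h1 := eq_const_of_address_eq_q (eq_q_of_P_eq_P h0 h)
  have h2 := eq_const_of_address_eq_q (eq_q_of_P_eq_P h0.symm h.symm)
  rw [addressValue_eq, addressValue_eq _ _ ω', h1, h2, addressValue_const, addressValue_const,
    subcell_comm]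

theorem addressValue_congr {b : Fin 3 → ℝ} {η : ℝ} {ω ω' : ℕ → Fin 3}
    (h : address ω = address ω') : addressValue b η ω = addressValue b η ω' := by
  by_cases hne : ω = ω'
  · rw [hne]
  obtain ⟨n, hn⟩ := Function.ne_iff.1 hne
  clear hne
  induction n generalizing b η ω ω' with
  | zero => exact addressValue_congr_of_ne h hn
  | succ n ih =>
    by_cases h0 : ω 0 = ω' 0
    · rw [address_eq ω, address_eq ω', h0] at h
      rw [addressValue_eq, addressValue_eq _ _ ω', h0]
      exact ih (P_injective _ h) hn
    · exact addressValue_congr_of_ne h h0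

theorem addressValue_surjInv (b : Fin 3 → ℝ) (η : ℝ) (ω : ℕ → Fin 3) :
    addressValue b η (Function.surjInv address_surjective (address ω)) = addressValue b η ω :=
  addressValue_congr (Function.surjInv_eq address_surjective _)

/-- The continuous function with boundary values `b` that satisfies `CellRule η`. -/
def interpolant (b : Fin 3 → ℝ) (η : ℝ) : C(SG, ℝ) where
  toFun x := addressValue b η (Function.surjInv address_surjective x)
  continuous_toFun := isQuotientMap_address.continuous_iff.2
    ((continuous_addressValue b η).congr fun ω => (addressValue_surjInv b η ω).symm)

theorem interpolant_address (b : Fin 3 → ℝ) (η : ℝ) (ω : ℕ → Fin 3) :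
    interpolant b η (address ω) = addressValue b η ω :=
  addressValue_surjInv b η ω

theorem address_const (i : Fin 3) : address (fun _ => i) = q i := by
  obtain ⟨ω, hω⟩ := address_surjective (q i)
  rw [← hω, eq_const_of_address_eq_q hω]

theorem interpolant_q (b : Fin 3 → ℝ) (η : ℝ) (i : Fin 3) : interpolant b η (q i) = b i := by
  rw [← address_const, interpolant_address, addressValue_const]

theorem interpolant_P (b : Fin 3 → ℝ) (η : ℝ) (i : Fin 3) (x : SG) :
    interpolant b η (P i x) = interpolant (subcell b η i) (η / 5) x := by
  obtain ⟨ω, rfl⟩ := address_surjective x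
  have h : address (fun n => Nat.casesOn n i ω) = P i (address ω) := address_eq _
  rw [← h, interpolant_address, interpolant_address, addressValue_eq]
  rfl

theorem cellRule_interpolant (b : Fin 3 → ℝ) (η : ℝ) : CellRule η (interpolant b η) := by
  intro w
  induction w generalizing b η with
  | nil =>
    intro i j k hij hjk hik
    have hs : ∑ l, b l = b i + b j + b k := by
      fin_cases i <;> fin_cases j <;> simp at hij <;> fin_cases k <;> simp at hik hjk <;>
        simp [Fin.sum_univ_three] <;> ring
    simp only [Function.comp_apply, Pword_nil, interpolant_P, interpolant_q, subcell,
      if_neg hij.symm, hs, List.length_nil, pow_zero, div_one]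
    ring
  | cons i w ih =>
    have := ih (subcell b η i) (η / 5)
    rw [div_div, ← pow_succ'] at this
    have h : interpolant b η ∘ Pword (i :: w) = interpolant (subcell b η i) (η / 5) ∘ Pword w :=
      funext fun x => interpolant_P b η i _
    rwa [h]

/-! ### Uniqueness: the discrete maximum principle -/

/-- The discrete maximum principle. -/
theorem le_of_graphLaplacian_pos {m : ℕ} {u : SG → ℝ} {c : ℝ}
    (hu : ∀ x ∈ V m, x ∉ V 0 → 0 < graphLaplacian m u x) (hc : ∀ i, u (q i) ≤ c) :
    ∀ x ∈ V m, u x ≤ c := by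
  obtain ⟨z, hz, hmax⟩ := (V m).exists_max_image u ⟨q 0, q_mem_V m 0⟩
  suffices u z ≤ c from fun x hx => (hmax x hx).trans this
  by_cases hz0 : z ∈ V 0
  · obtain ⟨i, rfl⟩ := mem_V_zero.1 hz0
    exact hc i
  · refine absurd (hu z hz hz0) (not_lt.2 ?_)
    classical
    -- At a maximum point every difference in the Laplacian is nonpositive.
    exact Finset.sum_nonpos fun y hy => sub_nonpos.2 (hmax y (Finset.mem_filter.1 hy).1)

theorem graphLaplacian_add (m : ℕ) (u v : SG → ℝ) (x : SG) :
    graphLaplacian m (u + v) x = graphLaplacian m u x + graphLaplacian m v x := by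
  simp only [graphLaplacian, ← Finset.sum_add_distrib, Pi.add_apply]
  exact Finset.sum_congr rfl fun y _ => by ring

theorem graphLaplacian_smul (m : ℕ) (c : ℝ) (u : SG → ℝ) (x : SG) :
    graphLaplacian m (c • u) x = c * graphLaplacian m u x := by
  simp only [graphLaplacian, Finset.mul_sum, Pi.smul_apply, smul_eq_mul]
  exact Finset.sum_congr rfl fun y _ => by ring

theorem dist_Pword (w : List (Fin 3)) (x y : SG) :
    dist (Pword w x) (Pword w y) = (1 / 2) ^ w.length * dist x y := by
  induction w with
  | nil => simp
  | cons i w ih =>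
    have h (x y : SG) : dist (P i x) (P i y) = 1 / 2 * dist x y := by
      rw [Subtype.dist_eq, Subtype.dist_eq]
      show dist (contraction i x) (contraction i y) = _
      rw [contraction, contraction, dist_smul₀, dist_add_right]
      norm_num
    rw [Pword_cons, Pword_cons, h, ih, List.length_cons, pow_succ]
    ring

theorem exists_eq_Pword (m : ℕ) (x : SG) : ∃ w y, w.length = m ∧ x = Pword w y := by
  induction m generalizing x with
  | zero => exact ⟨[], x, rfl, rfl⟩
  | succ m ih =>
    obtain ⟨ω, rfl⟩ := address_surjective x
    obtain ⟨w, y, hw, hy⟩ := ih (address fun k => ω (k + 1))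
    exact ⟨ω 0 :: w, y, by simp [hw], by rw [Pword_cons, ← hy, ← address_eq]⟩

theorem compactSpace_SG : CompactSpace SG :=
  isCompact_iff_compactSpace.1 gasket_isAttractor.isCompact

theorem dense_iUnion_V : Dense (⋃ m, (V m : Set SG)) := by
  intro x
  rw [Metric.mem_closure_iff]
  intro ε hε
  obtain ⟨C, hC⟩ := Metric.isBounded_iff.1 compactSpace_SG.isCompact_univ.isBounded
  have ht : Filter.Tendsto (fun n : ℕ => (1 / 2 : ℝ) ^ n * C) Filter.atTop (nhds 0) := by
    simpa using (tendsto_pow_atTop_nhds_zero_of_lt_one (by norm_num : (0 : ℝ) ≤ 1 / 2)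
      (by norm_num)).mul_const C
  obtain ⟨n, hn⟩ := (ht.eventually_lt_const hε).exists
  obtain ⟨w, y, rfl, rfl⟩ := exists_eq_Pword n x
  refine ⟨Pword w (q 0), Set.mem_iUnion.2 ⟨w.length, mem_V.2 ⟨w, rfl, 0, rfl⟩⟩, ?_⟩
  rw [dist_Pword]
  refine lt_of_le_of_lt ?_ hn
  gcongr
  exact hC (Set.mem_univ _) (Set.mem_univ _)

/-- A function with vanishing boundary values whose Laplacian vanishes off the boundary is
nonpositive. -/
theorem nonpos_of_hasLaplacian {v g : C(SG, ℝ)} (h : HasLaplacian v g)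
    (hg : ∀ x, x ∉ V 0 → g x = 0) (hv : ∀ i, v (q i) = 0) (x : SG) : v x ≤ 0 := by
  have := compactSpace_SG
  -- The maximum principle needs a strictly positive Laplacian, while that of `v` is only known to
  -- exceed `-ε` after renormalization. Adding `ε • ψ`, which vanishes on the boundary and has
  -- renormalized Laplacian exactly `ε`, makes up for this.
  let ψ := interpolant 0 1
  have hψ : CellRule 1 ψ := cellRule_interpolant 0 1
  have key (ε : ℝ) (hε : 0 < ε) (m : ℕ) (x : SG) (hx : x ∈ V m) : v x ≤ ε * ‖ψ‖ := by
    obtain ⟨M, hM⟩ := h ε hε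
    -- Level `max m M` is fine enough for the `ε`-estimate, and its vertex set still contains `V m`.
    have hmax := le_of_graphLaplacian_pos (m := max m M) (u := v + ε • ψ) (c := 0) ?_ ?_ x
      (V_mono (le_max_left m M) hx)
    · have h1 : v x + ε * ψ x ≤ 0 := hmax
      have h2 : -‖ψ‖ ≤ ψ x := (abs_le.1 (ψ.norm_coe_le_norm x)).1
      nlinarith
    · intro y hy hy0
      have h1 := hM (max m M) (le_max_right m M) y hy hy0
      rw [hg y hy0, sub_zero] at h1
      rw [graphLaplacian_add, graphLaplacian_smul, hψ.graphLaplacian_eq hy hy0]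
      have h2 := (abs_lt.1 h1).1
      have h5 : (5 : ℝ) ^ (max m M) * (1 / 5) ^ (max m M) = 1 := by rw [← mul_pow]; norm_num
      have h6 : (0 : ℝ) < 3 / 2 * 5 ^ (max m M) := by positivity
      refine pos_of_mul_pos_right (a := (3 / 2 : ℝ) * 5 ^ (max m M)) ?_ h6.le
      linear_combination h2 - ε * h5
    · intro i
      simp [hv, ψ, interpolant_q]
  have hV (m : ℕ) (x : SG) (hx : x ∈ V m) : v x ≤ 0 := by
    refine le_of_forall_pos_le_add fun δ hδ => ?_
    have hpos : 0 < ‖ψ‖ + 1 := by positivity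
    have h1 := key (δ / (‖ψ‖ + 1)) (by positivity) m x hx
    have h2 : δ / (‖ψ‖ + 1) * (‖ψ‖ + 1) = δ := div_mul_cancel₀ _ hpos.ne'
    have h3 : 0 < δ / (‖ψ‖ + 1) := by positivity
    linarith
  have hcl : IsClosed {x | v x ≤ 0} := isClosed_le v.continuous continuous_const
  refine hcl.closure_subset_iff.2 (fun x hx => ?_) (dense_iUnion_V x)
  obtain ⟨m, hm⟩ := Set.mem_iUnion.1 hx
  exact hV m x hm

theorem HasLaplacian.sub {u v g g' : C(SG, ℝ)} (hu : HasLaplacian u g) (hv : HasLaplacian v g') :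
    HasLaplacian (u - v) (g - g') := by
  intro ε hε
  obtain ⟨M, hM⟩ := hu (ε / 2) (half_pos hε)
  obtain ⟨M', hM'⟩ := hv (ε / 2) (half_pos hε)
  refine ⟨max M M', fun m hm x hx hx0 => ?_⟩
  have h1 := abs_lt.1 (hM m (le_of_max_le_left hm) x hx hx0)
  have h2 := abs_lt.1 (hM' m (le_of_max_le_right hm) x hx hx0)
  have e : graphLaplacian m (u - v : C(SG, ℝ)) x = graphLaplacian m u x - graphLaplacian m v x := by
    have := graphLaplacian_add m (u - v : C(SG, ℝ)) v x
    rw [ContinuousMap.coe_sub, sub_add_cancel] at this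
    rw [ContinuousMap.coe_sub]
    linarith
  rw [e, ContinuousMap.sub_apply, abs_lt]
  constructor <;> linarith

theorem IsDirichletSolution.unique {a : Fin 3 → ℝ} {η : ℝ} {u v : C(SG, ℝ)}
    (hu : IsDirichletSolution a η u) (hv : IsDirichletSolution a η v) : u = v := by
  have key {u v : C(SG, ℝ)} (hu : IsDirichletSolution a η u) (hv : IsDirichletSolution a η v)
      (x : SG) : u x ≤ v x := by
    obtain ⟨hua, g, hg, hgη⟩ := hu
    obtain ⟨hva, g', hg', hgη'⟩ := hv
    have := nonpos_of_hasLaplacian (hg.sub hg')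
      (fun x hx => by rw [ContinuousMap.sub_apply, hgη x hx, hgη' x hx, sub_self])
      (fun i => by rw [ContinuousMap.sub_apply, hua, hva, sub_self]) x
    exact sub_nonpos.1 this
  ext x
  exact le_antisymm (key hu hv x) (key hv hu x)

theorem isDirichletSolution_interpolant (a : Fin 3 → ℝ) (η : ℝ) :
    IsDirichletSolution a η (interpolant a η) :=
  (cellRule_interpolant a η).isDirichletSolution (interpolant_q a η)

/-- The rule is not extracted from the limit defining the Laplacian; uniqueness identifies `u` with
`interpolant a η`, which obeys it by construction. -/
theorem isDirichletSolution_iff_cellRule (a : Fin 3 → ℝ) (η : ℝ) (u : C(SG, ℝ)) :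
    IsDirichletSolution a η u ↔ CellRule η u ∧ ∀ i, u (q i) = a i := by
  constructor
  · intro h
    rw [h.unique (isDirichletSolution_interpolant a η)]
    exact ⟨cellRule_interpolant a η, interpolant_q a η⟩
  · exact fun h => h.1.isDirichletSolution h.2

end SierpinskiGasket

end

theorem mainTheorem4 (a : Fin 3 → ℝ) (η : ℝ) :
    (∃! u : C(SierpinskiGasket.SG, ℝ), SierpinskiGasket.IsDirichletSolution a η u) ∧
    (∀ u : C(SierpinskiGasket.SG, ℝ),
      SierpinskiGasket.IsDirichletSolution a η u ↔ SierpinskiGasket.IsDirichletFIF a η u) ∧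
    (∀ u : C(SierpinskiGasket.SG, ℝ),
      SierpinskiGasket.IsDirichletSolution a 0 u ↔
        SierpinskiGasket.IsHarmonic u ∧ ∀ i, u (SierpinskiGasket.q i) = a i) ∧
    (∀ u : C(SierpinskiGasket.SG, ℝ),
      SierpinskiGasket.IsHarmonic u → (∀ i, u (SierpinskiGasket.q i) = a i) →
        SierpinskiGasket.IsDirichletFIF a 0 u) := by
  refine ⟨⟨SierpinskiGasket.interpolant a η, SierpinskiGasket.isDirichletSolution_interpolant a η,
    fun u hu => hu.unique (SierpinskiGasket.isDirichletSolution_interpolant a η)⟩,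
    fun u => ?_, fun u => ?_, fun u hu ha => ?_⟩
  · rw [SierpinskiGasket.isDirichletSolution_iff_cellRule,
      SierpinskiGasket.isDirichletFIF_iff_cellRule]
  · rw [SierpinskiGasket.isDirichletSolution_iff_cellRule,
      SierpinskiGasket.isHarmonic_iff_cellRule]
  · exact (SierpinskiGasket.isDirichletFIF_iff_cellRule a 0 u).2
      ⟨(SierpinskiGasket.isHarmonic_iff_cellRule u).1 hu, ha⟩
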